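/- Let $(M,\varphi,\xi,\eta,g)$ be an almost contact metric manifold: $M$ is a smooth manifold without boundary, $g$ a smooth Riemannian metric, $\varphi$ a smooth field of endomorphisms of $TM$, $\xi$ a smooth vector field and $\eta$ a smooth 1-form, with $\varphi^2=-\mathrm{Id}+\eta\otimes\xi$, $\eta(\xi)=1$ and $g(\varphi X,\varphi Y)=g(X,Y)-\eta(X)\eta(Y)$. For a Riemannian metric with Levi-Civita connection $\nabla$ put $R_{XY}Z=\nabla_X\nabla_YZ-\nabla_Y\nabla_XZ-\nabla_{[X,Y]}Z$ and $R(X,Y,Z,W)=-g(R_{XY}Z,W)$. Let $\widetilde M=\mathbf R_+\times M$ be the metric cone, with $\mathbf R_+=(0,\infty)$ and coordinate $t$, carrying the metric $\widetilde g=dt^2+t^2g$ and the compatible almost complex structure $J$ given by $$J\partial_t=-\tfrac1t\,\xi,\qquad JX=\varphi X+t\,\eta(X)\,\partial_t\quad (X \text{ tangent to } M).$$ Let $\widetilde R$ be the Riemann–Christoffel tensor of $\widetilde g$, defined with the same conventions. Then $(\widetilde M,J,\widetilde g)$ satisfies Gray's identity $(K1)$: $\widetilde R(A,B,C,D)=\widetilde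 R(A,B,JC,JD)$ for all smooth vector fields $A,B,C,D$ on $\widetilde M$ if and only if, for all smooth vector fields $X,Y,Z,W$ on $M$, $$R(X,Y,Z,W)=R(X,Y,\varphi Z,\varphi W)-g(X,\varphi Z)g(Y,\varphi W)+g(Y,\varphi Z)g(X,\varphi W)-g(Y,Z)g(X,W)+g(X,Z)g(Y,W).$$ Equivalently, $\widetilde M$ is $(K1)$ if and only if $M$ satisfies the identity $(G1)$: for all smooth vector fields $X,Y,Z,W$ on $M$, $$R(X,Y,\varphi Z,\varphi W)-R(X,Y,Z,W)=g(Y,\varphi W)g(X,\varphi Z)-g(X,\varphi W)g(Y,\varphi Z)+g(X,W)g(Y,Z)-g(Y,W)g(X,Z).$$ -/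

import Mathlib

open scoped Manifold ContDiff

noncomputable section

namespace ConeGray

/-! ### Riemannian geometry on an open piece of a vector space -/

section Coordinates

variable {E : Type*} [NormedAddCommGroup E] [NormedSpace ℝ E]

/-- Christoffel symbols of the second kind of a metric `G` given in coordinates: `Γ(u, v)` is the
vector with `G(Γ(u, v), w) = (1/2) (∂_u G(v, w) + ∂_v G(u, w) - ∂_w G(u, v))` for all `w`. The
metric `G y`, as a map from vectors to covectors, is inverted to raise the index. -/
def christoffel (G : E → E →L[ℝ] E →L[ℝ] ℝ) (y u v : E) : E :=
  (G y).inverse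
    ((1 / 2 : ℝ) • (fderiv ℝ G y u v + fderiv ℝ G y v u - ((fderiv ℝ G y).flip u).flip v))

/-- The Levi-Civita connection in coordinates, `∇_X Y = DY(X) + Γ(X, Y)`. -/
def coordNabla (G : E → E →L[ℝ] E →L[ℝ] ℝ) (X Y : E → E) (y : E) : E :=
  fderiv ℝ Y y (X y) + christoffel G y (X y) (Y y)

/-- The curvature `R_{XY} Z = ∇_X ∇_Y Z - ∇_Y ∇_X Z - ∇_{[X, Y]} Z` in coordinates. -/
def coordCurvature (G : E → E →L[ℝ] E →L[ℝ] ℝ) (X Y Z : E → E) : E → E :=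
  coordNabla G X (coordNabla G Y Z) - coordNabla G Y (coordNabla G X Z)
    - coordNabla G (VectorField.lieBracket ℝ X Y) Z

end Coordinates

/-! ### Curvature of a Riemannian manifold, computed at each point in the chart at this point -/

section Manifold

variable {E : Type*} [NormedAddCommGroup E] [NormedSpace ℝ E]
  {H : Type*} [TopologicalSpace H] (I : ModelWithCorners ℝ E H)
  {M : Type*} [TopologicalSpace M] [ChartedSpace H M]

/-- The metric `g` in the chart at `x`, i.e. its pullback by the inverse of the chart. -/
def metricInChart (g : ∀ x : M, TangentSpace I x →L[ℝ] TangentSpace I x →L[ℝ] ℝ) (x : M) (y : E) :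
    E →L[ℝ] E →L[ℝ] ℝ :=
  let B : E →L[ℝ] E →L[ℝ] ℝ := g ((extChartAt I x).symm y)
  let A : E →L[ℝ] E := mfderiv 𝓘(ℝ, E) I (extChartAt I x).symm y
  B.bilinearComp A A

/-- The vector field `X` in the chart at `x`, i.e. its pullback by the inverse of the chart. -/
def fieldInChart (X : ∀ x : M, TangentSpace I x) (x : M) : E → E :=
  VectorField.mpullback 𝓘(ℝ, E) I (extChartAt I x).symm X

/-- The Riemann-Christoffel curvature tensor `R(X, Y, Z, W) = - g(R_{XY} Z, W)`, evaluated on vector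
fields at the point `x`. -/
def riemannChristoffel (g : ∀ x : M, TangentSpace I x →L[ℝ] TangentSpace I x →L[ℝ] ℝ)
    (X Y Z W : ∀ x : M, TangentSpace I x) (x : M) : ℝ :=
  - metricInChart I g x (extChartAt I x x)
      (coordCurvature (metricInChart I g x)
        (fieldInChart I X x) (fieldInChart I Y x) (fieldInChart I Z x) (extChartAt I x x))
      (fieldInChart I W x (extChartAt I x x))

variable [IsManifold I ∞ M]

/-- Smooth vector fields. -/
def IsSmoothField (X : ∀ x : M, TangentSpace I x) : Prop :=
  ContMDiff I I.tangent ∞ (fun x => (⟨x, X x⟩ : TangentBundle I M))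

/-- Gray's identity (K1) for a metric `g` and an endomorphism field `J`:
`R(X, Y, Z, W) = R(X, Y, JZ, JW)` for all smooth vector fields. -/
def GrayK1 (g : ∀ x : M, TangentSpace I x →L[ℝ] TangentSpace I x →L[ℝ] ℝ)
    (J : ∀ x : M, TangentSpace I x →L[ℝ] TangentSpace I x) : Prop :=
  ∀ X Y Z W : ∀ x : M, TangentSpace I x,
    IsSmoothField I X → IsSmoothField I Y → IsSmoothField I Z → IsSmoothField I W → ∀ x : M,
      riemannChristoffel I g X Y Z W x
        = riemannChristoffel I g X Y (fun p => J p (Z p)) (fun p => J p (W p)) x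

end Manifold

/-! ### Almost contact metric manifolds -/

/-- An almost contact metric structure `(φ, ξ, η, g)` on the manifold `M`. -/
structure AlmostContactMetric {E : Type*} [NormedAddCommGroup E] [NormedSpace ℝ E]
    {H : Type*} [TopologicalSpace H] (I : ModelWithCorners ℝ E H)
    (M : Type*) [TopologicalSpace M] [ChartedSpace H M] [IsManifold I ∞ M] where
  /-- the Riemannian metric -/
  g : Bundle.ContMDiffRiemannianMetric I ∞ E (fun x : M => TangentSpace I x)
  /-- the endomorphism field -/
  φ : ∀ x : M, TangentSpace I x →L[ℝ] TangentSpace I x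
  /-- the characteristic vector field -/
  ξ : ∀ x : M, TangentSpace I x
  /-- the 1-form -/
  η : ∀ x : M, TangentSpace I x →L[ℝ] ℝ
  smooth_φ : ContMDiff I (I.prod 𝓘(ℝ, E →L[ℝ] E)) ∞
    (fun x => Bundle.TotalSpace.mk' (E →L[ℝ] E)
      (E := fun x : M => TangentSpace I x →L[ℝ] TangentSpace I x) x (φ x))
  smooth_ξ : IsSmoothField I ξ
  smooth_η : ContMDiff I (I.prod 𝓘(ℝ, E →L[ℝ] ℝ)) ∞
    (fun x => Bundle.TotalSpace.mk' (E →L[ℝ] ℝ)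
      (E := fun x : M => TangentSpace I x →L[ℝ] ℝ) x (η x))
  φ_sq : ∀ (x : M) (v : TangentSpace I x), φ x (φ x v) = -v + η x v • ξ x
  η_ξ : ∀ x : M, η x (ξ x) = 1
  g_φ_φ : ∀ (x : M) (v w : TangentSpace I x),
    g.inner x (φ x v) (φ x w) = g.inner x v w - η x v * η x w

/-- The half-line `ℝ₊ = (0, ∞)` as an open submanifold of `ℝ`. -/
abbrev PosReal : TopologicalSpace.Opens ℝ := ⟨Set.Ioi 0, isOpen_Ioi⟩

/-- The manifold `ℝ₊ × M` underlying the metric cone. -/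
abbrev Cone (M : Type*) : Type _ := PosReal × M

/-- The model of the cone. The tangent space at `(t, p)` is `ℝ × T_p M`, where `(a, X)` stands for
`a ∂_t + X`. -/
abbrev coneModel {E : Type*} [NormedAddCommGroup E] [NormedSpace ℝ E]
    {H : Type*} [TopologicalSpace H] (I : ModelWithCorners ℝ E H) :
    ModelWithCorners ℝ (ℝ × E) (ModelProd ℝ H) :=
  𝓘(ℝ, ℝ).prod I

namespace AlmostContactMetric

variable {E : Type*} [NormedAddCommGroup E] [NormedSpace ℝ E]
  {H : Type*} [TopologicalSpace H] {I : ModelWithCorners ℝ E H}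
  {M : Type*} [TopologicalSpace M] [ChartedSpace H M] [IsManifold I ∞ M]

/-- The Riemann-Christoffel curvature tensor of `(M, g)`. -/
def R (S : AlmostContactMetric I M) (X Y Z W : ∀ x : M, TangentSpace I x) (x : M) : ℝ :=
  riemannChristoffel I S.g.inner X Y Z W x

/-- The vector field `φ X`. -/
def Phi (S : AlmostContactMetric I M) (X : ∀ x : M, TangentSpace I x) : ∀ x : M, TangentSpace I x :=
  fun x => S.φ x (X x)

/-- The cone metric `dt² + t² g`, i.e. `g̃((a, X), (b, Y)) = a b + t² g(X, Y)` at `(t, p)`. -/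
def coneMetric (S : AlmostContactMetric I M) (q : Cone M) :
    TangentSpace (coneModel I) q →L[ℝ] TangentSpace (coneModel I) q →L[ℝ] ℝ :=
  let t : ℝ := q.1
  let dt : ℝ × E →L[ℝ] ℝ := ContinuousLinearMap.fst ℝ ℝ E
  let pr : ℝ × E →L[ℝ] E := ContinuousLinearMap.snd ℝ ℝ E
  let G : E →L[ℝ] E →L[ℝ] ℝ := S.g.inner q.2
  (ContinuousLinearMap.mul ℝ ℝ).bilinearComp dt dt + t ^ 2 • G.bilinearComp pr pr

/-- The almost complex structure of the cone, `J(a, X) = (t η(X), φ X - (a / t) ξ)` at `(t, p)`. -/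
def coneJ (S : AlmostContactMetric I M) (q : Cone M) :
    TangentSpace (coneModel I) q →L[ℝ] TangentSpace (coneModel I) q :=
  let t : ℝ := q.1
  let dt : ℝ × E →L[ℝ] ℝ := ContinuousLinearMap.fst ℝ ℝ E
  let pr : ℝ × E →L[ℝ] E := ContinuousLinearMap.snd ℝ ℝ E
  let η : E →L[ℝ] ℝ := S.η q.2
  let φ : E →L[ℝ] E := S.φ q.2
  let ξ : E := S.ξ q.2
  (t • η.comp pr).prod (φ.comp pr - t⁻¹ • dt.smulRight ξ)

theorem coneMetric_apply (S : AlmostContactMetric I M) (q : Cone M) (a b : ℝ)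
    (X Y : TangentSpace I q.2) :
    S.coneMetric q ((a, X) : ℝ × E) ((b, Y) : ℝ × E)
      = a * b + (q.1 : ℝ) ^ 2 * S.g.inner q.2 X Y := rfl

theorem coneJ_apply (S : AlmostContactMetric I M) (q : Cone M) (a : ℝ) (X : TangentSpace I q.2) :
    S.coneJ q ((a, X) : ℝ × E)
      = (((q.1 : ℝ) * S.η q.2 X, S.φ q.2 X - (q.1 : ℝ)⁻¹ • a • S.ξ q.2) : ℝ × E) := rfl

theorem φ_ξ (S : AlmostContactMetric I M) (x : M) : S.φ x (S.ξ x) = 0 := by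
  by_contra h
  have h1 := S.g.pos x _ h
  rw [S.g_φ_φ, S.η_ξ] at h1
  have h2 := S.φ_sq x (S.ξ x)
  rw [S.η_ξ, one_smul, neg_add_cancel] at h2
  have h3 := S.φ_sq x (S.φ x (S.ξ x))
  rw [h2, map_zero] at h3
  have h4 := S.g_φ_φ x (S.φ x (S.ξ x)) (S.φ x (S.ξ x))
  have h5 := S.g_φ_φ x (S.ξ x) (S.ξ x)
  rw [S.η_ξ] at h5
  rw [h2] at h4
  simp only [map_zero, h5] at h4
  have h6 : S.φ x (S.ξ x) = S.η x (S.φ x (S.ξ x)) • S.ξ x := by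
    rw [eq_comm, neg_add_eq_zero] at h3
    exact h3
  have h7 : S.φ x (S.φ x (S.ξ x)) = S.η x (S.φ x (S.ξ x)) • S.φ x (S.ξ x) := by
    conv_lhs => rw [h6]
    rw [map_smul]
  rw [h2] at h7
  rcases smul_eq_zero.mp h7.symm with h8 | h8
  · rw [h8, zero_smul] at h6
    exact h h6
  · exact h h8

theorem η_φ (S : AlmostContactMetric I M) (x : M) (v : TangentSpace I x) :
    S.η x (S.φ x v) = 0 := by
  have h1 := S.φ_sq x (S.φ x v)
  rw [S.φ_sq x v, map_add, map_neg, map_smul, S.φ_ξ, smul_zero, add_zero] at h1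
  have h2 : S.η x (S.φ x v) • S.ξ x = 0 := by
    simpa using h1
  have h3 := congrArg (S.η x) h2
  rwa [map_smul, S.η_ξ, map_zero, smul_eq_mul, mul_one] at h3

theorem g_ξ (S : AlmostContactMetric I M) (x : M) (v : TangentSpace I x) :
    S.g.inner x v (S.ξ x) = S.η x v := by
  have h := S.g_φ_φ x v (S.ξ x)
  rw [S.φ_ξ, map_zero, S.η_ξ, mul_one] at h
  linarith

/-- `J` is an almost complex structure on the cone. -/
theorem coneJ_sq (S : AlmostContactMetric I M) (q : Cone M) (v : TangentSpace (coneModel I) q) :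
    S.coneJ q (S.coneJ q v) = -v := by
  have ht : (q.1 : ℝ) ≠ 0 := ne_of_gt q.1.2
  have h1 : ∀ (a : ℝ) (X : TangentSpace I q.2),
      (q.1 : ℝ) * S.η q.2 (S.φ q.2 X - (q.1 : ℝ)⁻¹ • a • S.ξ q.2) = -a := by
    intro a X
    rw [map_sub, map_smul, map_smul, S.η_φ, S.η_ξ]
    simp only [smul_eq_mul]
    field_simp
    ring
  have h2 : ∀ (a : ℝ) (X : TangentSpace I q.2),
      S.φ q.2 (S.φ q.2 X - (q.1 : ℝ)⁻¹ • a • S.ξ q.2)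
        - (q.1 : ℝ)⁻¹ • ((q.1 : ℝ) * S.η q.2 X) • S.ξ q.2 = -X := by
    intro a X
    rw [map_sub, map_smul, map_smul, S.φ_ξ, S.φ_sq, smul_smul _ (_ * _), inv_mul_cancel_left₀ ht]
    simp
  exact Prod.ext (h1 v.1 v.2) (h2 v.1 v.2)

/-- `J` is compatible with the cone metric. -/
theorem coneMetric_J_J (S : AlmostContactMetric I M) (q : Cone M)
    (v w : TangentSpace (coneModel I) q) :
    S.coneMetric q (S.coneJ q v) (S.coneJ q w) = S.coneMetric q v w := by
  have ht : (q.1 : ℝ) ≠ 0 := ne_of_gt q.1.2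
  have h : ∀ (a b : ℝ) (X Y : TangentSpace I q.2),
      ((q.1 : ℝ) * S.η q.2 X) * ((q.1 : ℝ) * S.η q.2 Y) + (q.1 : ℝ) ^ 2 *
        S.g.inner q.2 (S.φ q.2 X - (q.1 : ℝ)⁻¹ • a • S.ξ q.2)
          (S.φ q.2 Y - (q.1 : ℝ)⁻¹ • b • S.ξ q.2)
      = a * b + (q.1 : ℝ) ^ 2 * S.g.inner q.2 X Y := by
    intro a b X Y
    simp only [map_sub, map_smul, sub_apply, smul_apply,
      S.g_φ_φ, S.g_ξ, S.η_φ, S.g.symm q.2 (S.ξ q.2), S.η_ξ, smul_eq_mul]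
    field_simp
    ring
  exact h v.1 w.1 v.2 w.2

/-- The identity (G1): for all smooth vector fields,
`R(X, Y, φZ, φW) - R(X, Y, Z, W) = g(Y, φW) g(X, φZ) - g(X, φW) g(Y, φZ)
  + g(X, W) g(Y, Z) - g(Y, W) g(X, Z)`. -/
def IsG1 (S : AlmostContactMetric I M) : Prop :=
  ∀ X Y Z W : ∀ x : M, TangentSpace I x,
    IsSmoothField I X → IsSmoothField I Y → IsSmoothField I Z → IsSmoothField I W → ∀ x : M,
      S.R X Y (S.Phi Z) (S.Phi W) x - S.R X Y Z W x
        = S.g.inner x (Y x) (S.Phi W x) * S.g.inner x (X x) (S.Phi Z x)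
          - S.g.inner x (X x) (S.Phi W x) * S.g.inner x (Y x) (S.Phi Z x)
          + S.g.inner x (X x) (W x) * S.g.inner x (Y x) (Z x)
          - S.g.inner x (Y x) (W x) * S.g.inner x (X x) (Z x)

end AlmostContactMetric

end ConeGray

end

noncomputable section

set_option maxSynthPendingDepth 3

namespace ConeGray


section CoordinateCurvature

variable {E : Type*} [NormedAddCommGroup E] [NormedSpace ℝ E]

/-- The Christoffel symbols of a metric as a continuous bilinear map. -/
def christoffelL (G : E → E →L[ℝ] E →L[ℝ] ℝ) (y : E) : E →L[ℝ] E →L[ℝ] E :=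
  (1 / 2 : ℝ) • (ContinuousLinearMap.compL ℝ E (E →L[ℝ] ℝ) E (G y).inverse).comp
    (fderiv ℝ G y + (fderiv ℝ G y).flip
      - ((ContinuousLinearMap.flipₗᵢ ℝ E E ℝ : (E →L[ℝ] E →L[ℝ] ℝ) →L[ℝ] E →L[ℝ] E →L[ℝ] ℝ).comp
          (fderiv ℝ G y).flip))

theorem christoffelL_apply (G : E → E →L[ℝ] E →L[ℝ] ℝ) (y u v : E) :
    christoffelL G y u v = christoffel G y u v := by
  simp [christoffelL, christoffel]

/-- The curvature operator of the connection with bilinear Christoffel symbols `Γ`. -/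
def curvatureOp (Γ : E → E →L[ℝ] E →L[ℝ] E) (y u v w : E) : E :=
  fderiv ℝ Γ y u v w - fderiv ℝ Γ y v u w + Γ y u (Γ y v w) - Γ y v (Γ y u w)

theorem curvatureOp_congr {Γ Γ' : E → E →L[ℝ] E →L[ℝ] E} {y : E} (h : Γ =ᶠ[nhds y] Γ')
    (u v w : E) : curvatureOp Γ y u v w = curvatureOp Γ' y u v w := by
  simp only [curvatureOp, h.fderiv_eq, h.eq_of_nhds]

theorem contDiffAt_christoffelL [CompleteSpace E] {G : E → E →L[ℝ] E →L[ℝ] ℝ} {y : E}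
    (hG : ContDiffAt ℝ ∞ G y) (hinv : (G y).IsInvertible) :
    ContDiffAt ℝ ∞ (christoffelL G) y := by
  have hD : ContDiffAt ℝ ∞ (fderiv ℝ G) y := hG.fderiv_right (by simp)
  have hI : ContDiffAt ℝ ∞ (fun z => (G z).inverse) y :=
    (hinv.contDiffAt_map_inverse (n := ∞)).comp y hG
  have hF : ContDiffAt ℝ ∞ (fun z => (fderiv ℝ G z).flip) y :=
    (ContinuousLinearMap.flipₗᵢ ℝ E E (E →L[ℝ] ℝ)).contDiff.contDiffAt.comp y hD
  have hL := (ContinuousLinearMap.compL ℝ E (E →L[ℝ] ℝ) E).contDiff.contDiffAt.comp y hI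
  exact (hL.clm_comp ((hD.add hF).sub (contDiffAt_const.clm_comp hF))).const_smul (1 / 2 : ℝ)

theorem coordNabla_eq (G : E → E →L[ℝ] E →L[ℝ] ℝ) (X Y : E → E) :
    coordNabla G X Y = fun z => fderiv ℝ Y z (X z) + christoffelL G z (X z) (Y z) := by
  ext z
  rw [coordNabla, christoffelL_apply]

theorem fderiv_coordNabla {G : E → E →L[ℝ] E →L[ℝ] ℝ} {Y Z : E → E} {y : E}
    (hΓ : DifferentiableAt ℝ (christoffelL G) y) (hY : DifferentiableAt ℝ Y y)
    (hZ : DifferentiableAt ℝ Z y) (hZ' : DifferentiableAt ℝ (fderiv ℝ Z) y) (u : E) :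
    fderiv ℝ (coordNabla G Y Z) y u
      = fderiv ℝ (fderiv ℝ Z) y u (Y y) + fderiv ℝ Z y (fderiv ℝ Y y u)
        + (fderiv ℝ (christoffelL G) y u (Y y) (Z y)
          + christoffelL G y (fderiv ℝ Y y u) (Z y) + christoffelL G y (Y y) (fderiv ℝ Z y u)) := by
  rw [coordNabla_eq]
  have h := (hZ'.hasFDerivAt.clm_apply hY.hasFDerivAt).add
    ((hΓ.hasFDerivAt.clm_apply hY.hasFDerivAt).clm_apply hZ.hasFDerivAt)
  have h' := congrArg (fun L => L u) h.fderiv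
  refine h'.trans ?_
  simp
  abel

/-- The coordinate curvature depends only on the values of the fields at the point. -/
theorem coordCurvature_eq {G : E → E →L[ℝ] E →L[ℝ] ℝ} {X Y Z : E → E} {y : E}
    (hΓ : DifferentiableAt ℝ (christoffelL G) y) (hX : DifferentiableAt ℝ X y)
    (hY : DifferentiableAt ℝ Y y) (hZ : ContDiffAt ℝ 2 Z y) :
    coordCurvature G X Y Z y = curvatureOp (christoffelL G) y (X y) (Y y) (Z y) := by
  have hZ1 : DifferentiableAt ℝ Z y := hZ.differentiableAt (by simp)
  have hZ2 : DifferentiableAt ℝ (fderiv ℝ Z) y :=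
    (hZ.fderiv_right (m := 1) (by norm_num)).differentiableAt (by simp)
  have hs : IsSymmSndFDerivAt ℝ Z y := hZ.isSymmSndFDerivAt (by simp)
  have e : coordCurvature G X Y Z y = coordNabla G X (coordNabla G Y Z) y
      - coordNabla G Y (coordNabla G X Z) y - coordNabla G (VectorField.lieBracket ℝ X Y) Z y := rfl
  rw [e, coordNabla_eq G X, coordNabla_eq G Y (coordNabla G X Z)]
  simp only [fderiv_coordNabla hΓ hY hZ1 hZ2, fderiv_coordNabla hΓ hX hZ1 hZ2]
  simp only [coordNabla_eq, VectorField.lieBracket, curvatureOp, map_add, map_sub,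
    sub_apply, hs.eq (X y) (Y y)]
  abel

end CoordinateCurvature

section Metric

variable {E : Type*} [NormedAddCommGroup E] [NormedSpace ℝ E]

theorem isInvertible_of_posDef [FiniteDimensional ℝ E] {B : E →L[ℝ] E →L[ℝ] ℝ}
    (h : ∀ v, v ≠ 0 → 0 < B v v) : B.IsInvertible := by
  have hinj : Function.Injective (B : E →ₗ[ℝ] E →L[ℝ] ℝ) := by
    rw [injective_iff_map_eq_zero]
    intro v hv
    by_contra hne
    have h1 := h v hne
    have h2 : B v = 0 := hv
    simp [h2] at h1
  have hdim : Module.finrank ℝ E = Module.finrank ℝ (E →L[ℝ] ℝ) := by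
    rw [← (LinearMap.toContinuousLinearMap : (E →ₗ[ℝ] ℝ) ≃ₗ[ℝ] _).finrank_eq]
    exact (Subspace.dual_finrank_eq).symm
  let e := (LinearEquiv.ofInjectiveOfFinrankEq (B : E →ₗ[ℝ] E →L[ℝ] ℝ) hinj
    hdim).toContinuousLinearEquiv
  exact ⟨e, by ext; rfl⟩

theorem apply_christoffel {G : E → E →L[ℝ] E →L[ℝ] ℝ} {y : E} (h : (G y).IsInvertible)
    (u v w : E) : G y (christoffel G y u v) w
      = (1 / 2 : ℝ) * (fderiv ℝ G y u v w + fderiv ℝ G y v u w - fderiv ℝ G y w u v) := by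
  rw [christoffel, h.self_apply_inverse]
  simp

theorem christoffel_eq_of_forall {G : E → E →L[ℝ] E →L[ℝ] ℝ} {y u v c : E}
    (h : (G y).IsInvertible)
    (hc : ∀ w, G y c w
      = (1 / 2 : ℝ) * (fderiv ℝ G y u v w + fderiv ℝ G y v u w - fderiv ℝ G y w u v)) :
    christoffel G y u v = c := by
  have : G y (christoffel G y u v) = G y c := by
    ext w
    rw [apply_christoffel h, hc]
  exact h.injective this

end Metric


section ConeCoordinates

variable {E : Type*} [NormedAddCommGroup E] [NormedSpace ℝ E]

/-- The cone metric `ds² + s² G` in coordinates. -/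
def coneCoordMetric (G : E → E →L[ℝ] E →L[ℝ] ℝ) (p : ℝ × E) : ℝ × E →L[ℝ] ℝ × E →L[ℝ] ℝ :=
  (ContinuousLinearMap.mul ℝ ℝ).bilinearComp (ContinuousLinearMap.fst ℝ ℝ E)
      (ContinuousLinearMap.fst ℝ ℝ E)
    + p.1 ^ 2 • (G p.2).bilinearComp (ContinuousLinearMap.snd ℝ ℝ E)
      (ContinuousLinearMap.snd ℝ ℝ E)

theorem coneCoordMetric_apply (G : E → E →L[ℝ] E →L[ℝ] ℝ) (p A B : ℝ × E) :
    coneCoordMetric G p A B = A.1 * B.1 + p.1 ^ 2 * G p.2 A.2 B.2 := rfl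

theorem fderiv_coneCoordMetric {G : E → E →L[ℝ] E →L[ℝ] ℝ} {p : ℝ × E}
    (hd : DifferentiableAt ℝ (coneCoordMetric G) p) (hG : DifferentiableAt ℝ G p.2)
    (A B C : ℝ × E) :
    fderiv ℝ (coneCoordMetric G) p A B C
      = 2 * p.1 * A.1 * G p.2 B.2 C.2 + p.1 ^ 2 * fderiv ℝ G p.2 A.2 B.2 C.2 := by
  have h1 := ((hd.hasFDerivAt.clm_apply (hasFDerivAt_const B p)).clm_apply (hasFDerivAt_const C p))
  have h2 : HasFDerivAt (fun q : ℝ × E => G q.2) ((fderiv ℝ G p.2).comp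
      (ContinuousLinearMap.snd ℝ ℝ E)) p := hG.hasFDerivAt.comp p hasFDerivAt_snd
  have h3 := ((hasFDerivAt_fst (𝕜 := ℝ) (p := p)).pow 2).mul
    ((h2.clm_apply (hasFDerivAt_const B.2 p)).clm_apply (hasFDerivAt_const C.2 p))
  have h4 := (h3.const_add (B.1 * C.1))
  have h5 := congrArg (fun L => L A) (h1.unique h4)
  simp at h5
  rw [h5]
  ring

theorem coneCoordMetric_pos {G : E → E →L[ℝ] E →L[ℝ] ℝ} {p : ℝ × E} (hp : p.1 ≠ 0)
    (h : ∀ v, v ≠ 0 → 0 < G p.2 v v) (A : ℝ × E) (hA : A ≠ 0) :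
    0 < coneCoordMetric G p A A := by
  rw [coneCoordMetric_apply]
  have hp2 : 0 < p.1 ^ 2 := by positivity
  by_cases h2 : A.2 = 0
  · have h1 : A.1 ≠ 0 := fun h1 => hA (Prod.ext h1 h2)
    have : 0 < A.1 * A.1 := mul_self_pos.mpr h1
    simpa [h2] using this
  · have := mul_pos hp2 (h _ h2)
    have := mul_self_nonneg A.1
    linarith

/-- A `C^∞` metric near a point of a vector space. -/
structure IsMetricAt (G : E → E →L[ℝ] E →L[ℝ] ℝ) (y : E) : Prop where
  contDiffAt : ContDiffAt ℝ ∞ G y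
  symm : ∀ᶠ z in nhds y, ∀ u v, G z u v = G z v u
  pos : ∀ u, u ≠ 0 → 0 < G y u u

theorem IsMetricAt.isInvertible [FiniteDimensional ℝ E] {G : E → E →L[ℝ] E →L[ℝ] ℝ} {y : E}
    (h : IsMetricAt G y) : (G y).IsInvertible :=
  isInvertible_of_posDef h.pos

theorem IsMetricAt.differentiableAt {G : E → E →L[ℝ] E →L[ℝ] ℝ} {y : E}
    (h : IsMetricAt G y) : DifferentiableAt ℝ G y :=
  h.contDiffAt.differentiableAt (by simp)

theorem IsMetricAt.differentiableAt_christoffelL [FiniteDimensional ℝ E]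
    {G : E → E →L[ℝ] E →L[ℝ] ℝ} {y : E} (h : IsMetricAt G y) :
    DifferentiableAt ℝ (christoffelL G) y :=
  haveI := FiniteDimensional.complete ℝ E
  (contDiffAt_christoffelL h.contDiffAt h.isInvertible).differentiableAt (by simp)

theorem IsMetricAt.fderiv_symm {G : E → E →L[ℝ] E →L[ℝ] ℝ} {y : E}
    (h : IsMetricAt G y) (u v w : E) : fderiv ℝ G y u v w = fderiv ℝ G y u w v := by
  have h1 (v w : E) := (h.differentiableAt.hasFDerivAt.clm_apply (hasFDerivAt_const v y)).clm_apply
    (hasFDerivAt_const w y)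
  have h2 : (fun z => G z v w) =ᶠ[nhds y] fun z => G z w v := by
    filter_upwards [h.symm] with z hz using hz v w
  have h3 := congrArg (fun L => L u) ((h1 v w).unique ((h1 w v).congr_of_eventuallyEq h2))
  simpa using h3

theorem IsMetricAt.christoffelL_symm {G : E → E →L[ℝ] E →L[ℝ] ℝ} {y : E}
    (h : IsMetricAt G y) (u v : E) : christoffelL G y u v = christoffelL G y v u := by
  rw [christoffelL_apply, christoffelL_apply, christoffel, christoffel]
  congr 2
  ext w
  simp [h.fderiv_symm w u v, add_comm]

/-- Christoffel symbols of the cone metric. -/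
theorem christoffelL_coneCoordMetric [FiniteDimensional ℝ E] {G : E → E →L[ℝ] E →L[ℝ] ℝ}
    {p : ℝ × E} (hp : p.1 ≠ 0) (h : IsMetricAt G p.2) (hC : IsMetricAt (coneCoordMetric G) p)
    (A B : ℝ × E) :
    christoffelL (coneCoordMetric G) p A B = (-(p.1 * G p.2 A.2 B.2),
      christoffelL G p.2 A.2 B.2 + p.1⁻¹ • (A.1 • B.2 + B.1 • A.2)) := by
  rw [christoffelL_apply]
  refine christoffel_eq_of_forall hC.isInvertible fun W => ?_
  simp only [fderiv_coneCoordMetric hC.differentiableAt h.differentiableAt, coneCoordMetric_apply,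
    map_add, map_smul, add_apply, smul_apply, smul_eq_mul, christoffelL_apply,
    apply_christoffel h.isInvertible]
  rw [h.symm.self_of_nhds A.2 B.2]
  field_simp
  ring

theorem IsMetricAt.coneCoordMetric {G : E → E →L[ℝ] E →L[ℝ] ℝ} {p : ℝ × E} (hp : p.1 ≠ 0)
    (h : IsMetricAt G p.2) : IsMetricAt (coneCoordMetric G) p where
  contDiffAt := by
    have h1 : ContDiffAt ℝ ∞ (fun q : ℝ × E => G q.2) p := h.contDiffAt.comp p contDiffAt_snd
    have h2 : ContDiffAt ℝ ∞ (fun q : ℝ × E => (G q.2).bilinearComp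
        (ContinuousLinearMap.snd ℝ ℝ E) (ContinuousLinearMap.snd ℝ ℝ E)) p := by
      have h3 := (ContinuousLinearMap.flipₗᵢ ℝ (ℝ × E) E ℝ).contDiff.contDiffAt.comp p
        (h1.clm_comp (contDiffAt_const (c := ContinuousLinearMap.snd ℝ ℝ E)))
      exact (ContinuousLinearMap.flipₗᵢ ℝ (ℝ × E) (ℝ × E) ℝ).contDiff.contDiffAt.comp p
        (h3.clm_comp (contDiffAt_const (c := ContinuousLinearMap.snd ℝ ℝ E)))
    exact contDiffAt_const.add ((contDiffAt_fst.pow 2).smul h2)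
  symm := by
    filter_upwards [continuousAt_snd.eventually h.symm] with q hq A B
    rw [coneCoordMetric_apply, coneCoordMetric_apply, hq, mul_comm A.1]
  pos := coneCoordMetric_pos hp h.pos

/-- The curvature of the cone metric: `∂_t` is in the nullity, and the horizontal part differs from
the curvature of the base by that of the unit sphere. -/
theorem curvatureOp_coneCoordMetric [FiniteDimensional ℝ E] {G : E → E →L[ℝ] E →L[ℝ] ℝ}
    {p : ℝ × E} (hp : p.1 ≠ 0) (h : ∀ᶠ z in nhds p.2, IsMetricAt G z) (A B C : ℝ × E) :
    curvatureOp (christoffelL (coneCoordMetric G)) p A B C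
      = (0, curvatureOp (christoffelL G) p.2 A.2 B.2 C.2 - G p.2 B.2 C.2 • A.2
          + G p.2 A.2 C.2 • B.2) := by
  have h0 := h.self_of_nhds
  have hC0 := h0.coneCoordMetric hp
  have hev (B C : ℝ × E) : (fun q => christoffelL (coneCoordMetric G) q B C) =ᶠ[nhds p]
      fun q => (-(q.1 * G q.2 B.2 C.2),
        christoffelL G q.2 B.2 C.2 + q.1⁻¹ • (B.1 • C.2 + C.1 • B.2)) := by
    filter_upwards [continuousAt_snd.eventually h, continuousAt_fst.eventually_ne hp] with q hq hq1
    exact christoffelL_coneCoordMetric hq1 hq (hq.coneCoordMetric hq1) B C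
  have hD (A B C : ℝ × E) : fderiv ℝ (christoffelL (coneCoordMetric G)) p A B C
      = (-(A.1 * G p.2 B.2 C.2 + p.1 * fderiv ℝ G p.2 A.2 B.2 C.2),
        fderiv ℝ (christoffelL G) p.2 A.2 B.2 C.2
          - (A.1 * (p.1 ^ 2)⁻¹) • (B.1 • C.2 + C.1 • B.2)) := by
    have h1 := ((hC0.differentiableAt_christoffelL.hasFDerivAt.clm_apply
      (hasFDerivAt_const B p)).clm_apply (hasFDerivAt_const C p))
    have h2 : HasFDerivAt (fun q : ℝ × E => G q.2) ((fderiv ℝ G p.2).comp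
      (ContinuousLinearMap.snd ℝ ℝ E)) p := h0.differentiableAt.hasFDerivAt.comp p hasFDerivAt_snd
    have h3 : HasFDerivAt (fun q : ℝ × E => christoffelL G q.2) ((fderiv ℝ (christoffelL G) p.2).comp
      (ContinuousLinearMap.snd ℝ ℝ E)) p :=
        h0.differentiableAt_christoffelL.hasFDerivAt.comp p hasFDerivAt_snd
    have h4 := ((hasFDerivAt_fst (𝕜 := ℝ) (p := p)).mul
      ((h2.clm_apply (hasFDerivAt_const B.2 p)).clm_apply (hasFDerivAt_const C.2 p))).neg
    have h5 : HasFDerivAt (fun q : ℝ × E => q.1⁻¹) _ p :=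
      (hasDerivAt_inv hp).comp_hasFDerivAt p (hasFDerivAt_fst (𝕜 := ℝ) (p := p))
    have h6 := ((h3.clm_apply (hasFDerivAt_const B.2 p)).clm_apply (hasFDerivAt_const C.2 p)).add
      (h5.smul_const (B.1 • C.2 + C.1 • B.2))
    have h7 := congrArg (fun L => L A) (h1.unique ((h4.prodMk h6).congr_of_eventuallyEq (hev B C)))
    simp at h7
    rw [h7]
    refine Prod.ext ?_ ?_
    · simp; ring
    · simp only [sub_eq_add_neg, neg_add, smul_add, mul_comm A.1]
  simp only [curvatureOp, hD, christoffelL_coneCoordMetric hp h0 hC0]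
  refine Prod.ext ?_ ?_
  · have hk (u v w : E) : G p.2 u (christoffelL G p.2 v w) = (1 / 2 : ℝ) *
        (fderiv ℝ G p.2 v w u + fderiv ℝ G p.2 w v u - fderiv ℝ G p.2 u v w) := by
      rw [h0.symm.self_of_nhds, christoffelL_apply, apply_christoffel h0.isInvertible]
    simp only [map_add, map_smul, smul_eq_mul, Prod.fst_sub, Prod.fst_add, hk,
      h0.symm.self_of_nhds A.2 B.2, h0.fderiv_symm C.2 B.2 A.2, h0.fderiv_symm A.2 C.2 B.2,
      h0.fderiv_symm B.2 C.2 A.2]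
    field_simp
    ring
  · simp only [Prod.snd_sub, Prod.snd_add, map_add, map_smul, h0.christoffelL_symm B.2 A.2]
    match_scalars <;> field_simp <;> ring

end ConeCoordinates


section ManifoldCurvature

variable {E : Type*} [NormedAddCommGroup E] [NormedSpace ℝ E]
  {H : Type*} [TopologicalSpace H] {I : ModelWithCorners ℝ E H} [I.Boundaryless]
  {M : Type*} [TopologicalSpace M] [ChartedSpace H M] [IsManifold I ∞ M]

theorem mfderiv_extChartAt_symm_self (x : M) :
    (mfderiv 𝓘(ℝ, E) I (extChartAt I x).symm (extChartAt I x x) : E →L[ℝ] E)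
      = ContinuousLinearMap.id ℝ E := by
  have : IsManifold I 1 M := IsManifold.of_le (n := ∞) (by simp)
  have h := mfderivWithin_range_extChartAt_symm (I := I) (x := x)
  rw [I.range_eq_univ, mfderivWithin_univ] at h
  exact h

theorem isInvertible_mfderiv_extChartAt_symm {x : M} {y : E} (hy : y ∈ (extChartAt I x).target) :
    (mfderiv 𝓘(ℝ, E) I (extChartAt I x).symm y).IsInvertible := by
  have : IsManifold I 1 M := IsManifold.of_le (n := ∞) (by simp)
  have h := isInvertible_mfderivWithin_extChartAt_symm hy
  rw [I.range_eq_univ, mfderivWithin_univ] at h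
  exact h

theorem fieldInChart_self (X : ∀ x : M, TangentSpace I x) (x : M) :
    fieldInChart I X x (extChartAt I x x) = X x := by
  have h1 : ∀ A : E →L[ℝ] E, A = ContinuousLinearMap.id ℝ E → ∀ v : E, A.inverse v = v := by
    rintro _ rfl v
    rw [ContinuousLinearMap.inverse_id, ContinuousLinearMap.id_apply]
  have h2 : ∀ z, z = x → (X z : E) = X x := by rintro _ rfl; rfl
  exact (h1 _ (mfderiv_extChartAt_symm_self x) _).trans (h2 _ (extChartAt_to_inv x))

omit [I.Boundaryless] [IsManifold I ∞ M] in
theorem metricInChart_apply (g : ∀ x : M, TangentSpace I x →L[ℝ] TangentSpace I x →L[ℝ] ℝ) (x : M)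
    (y u v : E) : metricInChart I g x y u v = g ((extChartAt I x).symm y)
      (mfderiv 𝓘(ℝ, E) I (extChartAt I x).symm y u)
      (mfderiv 𝓘(ℝ, E) I (extChartAt I x).symm y v) := rfl

theorem metricInChart_self (g : ∀ x : M, TangentSpace I x →L[ℝ] TangentSpace I x →L[ℝ] ℝ) (x : M) :
    metricInChart I g x (extChartAt I x x) = (g x : E →L[ℝ] E →L[ℝ] ℝ) := by
  have h1 : ∀ B : E →L[ℝ] E →L[ℝ] ℝ, ∀ A : E →L[ℝ] E, A = ContinuousLinearMap.id ℝ E →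
      B.bilinearComp A A = B := by
    rintro B _ rfl
    rfl
  have h2 : ∀ z, z = x → (g z : E →L[ℝ] E →L[ℝ] ℝ) = g x := by rintro _ rfl; rfl
  exact (h1 _ _ (mfderiv_extChartAt_symm_self x)).trans (h2 _ (extChartAt_to_inv x))

theorem contDiffAt_fieldInChart [CompleteSpace E] {X : ∀ x : M, TangentSpace I x}
    (hX : IsSmoothField I X) (x : M) :
    ContDiffAt ℝ ∞ (fieldInChart I X x) (extChartAt I x x) := by
  have : IsManifold I 1 M := IsManifold.of_le (n := ∞) (by simp)
  have ht : (extChartAt I x).target ∈ nhds (extChartAt I x x) := extChartAt_target_mem_nhds x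
  have h := ContMDiffAt.mpullback_vectorField_preimage (m := ∞) (n := ∞) (V := X)
    (hX ((extChartAt I x).symm (extChartAt I x x)))
    ((contMDiffOn_extChartAt_symm (n := ∞) (I := I) x).contMDiffAt ht)
    (isInvertible_mfderiv_extChartAt_symm (mem_extChartAt_target x)) (by simp)
  exact contMDiffAt_vectorSpace_iff_contDiffAt.mp h

theorem contMDiffOn_extChartAt_symm_tangent (x : M) (u : E) :
    ContMDiffOn 𝓘(ℝ, E) I.tangent ∞ (fun y : E => (⟨(extChartAt I x).symm y,
      mfderiv 𝓘(ℝ, E) I (extChartAt I x).symm y u⟩ : TangentBundle I M)) (extChartAt I x).target := by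
  have : IsManifold I 1 M := IsManifold.of_le (n := ∞) (by simp)
  have ho : IsOpen (extChartAt I x).target := isOpen_extChartAt_target x
  have h := (contMDiffOn_extChartAt_symm (n := ∞) (I := I) x).contMDiffOn_tangentMapWithin
    (m := ∞) (by simp) ho.uniqueMDiffOn
  have h2 : ContMDiffOn 𝓘(ℝ, E) 𝓘(ℝ, E).tangent ∞
      (fun y : E => (⟨y, u⟩ : TangentBundle 𝓘(ℝ, E) E)) (extChartAt I x).target :=
    contMDiffOn_vectorSpace_iff_contDiffOn.mpr contDiffOn_const
  refine (h.comp h2 fun y hy => hy).congr fun y hy => ?_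
  simp only [Function.comp, tangentMapWithin, mfderivWithin_of_isOpen ho hy]

theorem contDiffOn_metricInChart [FiniteDimensional ℝ E]
    (g : Bundle.ContMDiffRiemannianMetric I ∞ E (fun x : M => TangentSpace I x)) (x : M) :
    ContDiffOn ℝ ∞ (metricInChart I g.inner x) (extChartAt I x).target := by
  refine contDiffOn_clm_apply.mpr fun u => contDiffOn_clm_apply.mpr fun v => ?_
  have hg := g.contMDiff.comp_contMDiffOn (contMDiffOn_extChartAt_symm (n := ∞) (I := I) x)
  have h : ContMDiffOn 𝓘(ℝ, E) (I.prod 𝓘(ℝ, ℝ)) ∞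
      (fun y : E => Bundle.TotalSpace.mk' ℝ (E := Bundle.Trivial M ℝ) ((extChartAt I x).symm y)
        (metricInChart I g.inner x y u v)) (extChartAt I x).target :=
    ContMDiffOn.clm_bundle_apply₂ (F₁ := E) (F₂ := E) (F₃ := ℝ)
      (E₁ := fun x : M => TangentSpace I x) (E₂ := fun x : M => TangentSpace I x) (E₃ := Bundle.Trivial M ℝ)
      (b := (extChartAt I x).symm) (ψ := fun y => g.inner ((extChartAt I x).symm y))
      (v := fun y => mfderiv 𝓘(ℝ, E) I (extChartAt I x).symm y u)
      (w := fun y => mfderiv 𝓘(ℝ, E) I (extChartAt I x).symm y v)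
      hg (contMDiffOn_extChartAt_symm_tangent x u) (contMDiffOn_extChartAt_symm_tangent x v)
  refine contMDiffOn_iff_contDiffOn.mp fun y hy => ?_
  exact ((Bundle.contMDiffWithinAt_totalSpace).mp (h y hy)).2

theorem isMetricAt_metricInChart [FiniteDimensional ℝ E]
    (g : Bundle.ContMDiffRiemannianMetric I ∞ E (fun x : M => TangentSpace I x)) (x : M) {y : E}
    (hy : y ∈ (extChartAt I x).target) : IsMetricAt (metricInChart I g.inner x) y where
  contDiffAt := (contDiffOn_metricInChart g x).contDiffAt ((isOpen_extChartAt_target x).mem_nhds hy)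
  symm := Filter.Eventually.of_forall fun z u v => by
    rw [metricInChart_apply, metricInChart_apply, g.symm]
  pos u hu := by
    rw [metricInChart_apply]
    refine g.pos _ _ fun h => hu ?_
    exact (isInvertible_mfderiv_extChartAt_symm hy).injective (h.trans (map_zero _).symm)

theorem riemannChristoffel_eq [FiniteDimensional ℝ E]
    {g : ∀ x : M, TangentSpace I x →L[ℝ] TangentSpace I x →L[ℝ] ℝ}
    {x : M} {G : E → E →L[ℝ] E →L[ℝ] ℝ}
    (hG : metricInChart I g x =ᶠ[nhds (extChartAt I x x)] G)
    (hm : IsMetricAt G (extChartAt I x x))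
    {X Y Z : ∀ x : M, TangentSpace I x} (W : ∀ x : M, TangentSpace I x)
    (hX : IsSmoothField I X) (hY : IsSmoothField I Y) (hZ : IsSmoothField I Z) :
    riemannChristoffel I g X Y Z W x
      = -G (extChartAt I x x) (curvatureOp (christoffelL G) (extChartAt I x x) (X x) (Y x) (Z x))
          (W x) := by
  have := FiniteDimensional.complete ℝ E
  have hΓ : christoffelL (metricInChart I g x) =ᶠ[nhds (extChartAt I x x)] christoffelL G := by
    filter_upwards [hG, hG.fderiv (𝕜 := ℝ)] with y h1 h2
    rw [christoffelL, christoffelL, h1, h2]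
  have hd : DifferentiableAt ℝ (christoffelL (metricInChart I g x)) (extChartAt I x x) :=
    hm.differentiableAt_christoffelL.congr_of_eventuallyEq hΓ
  rw [riemannChristoffel, coordCurvature_eq hd
    ((contDiffAt_fieldInChart hX x).differentiableAt (by simp))
    ((contDiffAt_fieldInChart hY x).differentiableAt (by simp))
    (contDiffAt_infty.mp (contDiffAt_fieldInChart hZ x) 2), curvatureOp_congr hΓ, hG.eq_of_nhds]
  simp only [fieldInChart_self]

end ManifoldCurvature


section HalfLine

theorem extChartAt_posReal_symm (t : PosReal) {s : ℝ} (hs : 0 < s) :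
    (extChartAt 𝓘(ℝ, ℝ) t).symm s = ⟨s, hs⟩ :=
  extChartAt_to_inv (I := 𝓘(ℝ, ℝ)) (⟨s, hs⟩ : PosReal)

theorem mem_extChartAt_posReal_target (t : PosReal) {s : ℝ} (hs : 0 < s) :
    s ∈ (extChartAt 𝓘(ℝ, ℝ) t).target :=
  mem_extChartAt_target (I := 𝓘(ℝ, ℝ)) (⟨s, hs⟩ : PosReal)

theorem mfderiv_extChartAt_posReal_symm (t : PosReal) {s : ℝ} (hs : 0 < s) :
    (mfderiv 𝓘(ℝ, ℝ) 𝓘(ℝ, ℝ) (extChartAt 𝓘(ℝ, ℝ) t).symm s : ℝ →L[ℝ] ℝ)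
      = ContinuousLinearMap.id ℝ ℝ :=
  mfderiv_extChartAt_symm_self (I := 𝓘(ℝ, ℝ)) (⟨s, hs⟩ : PosReal)

theorem contMDiff_dt : ContMDiff 𝓘(ℝ, ℝ) 𝓘(ℝ, ℝ).tangent ∞
    (fun t : PosReal => (⟨t, (1 : ℝ)⟩ : TangentBundle 𝓘(ℝ, ℝ) PosReal)) := by
  intro t
  have h := (contMDiffOn_extChartAt_symm_tangent (I := 𝓘(ℝ, ℝ)) t 1).contMDiffAt
    (extChartAt_target_mem_nhds t)
  have h2 := h.comp t (contMDiffAt_extChartAt (I := 𝓘(ℝ, ℝ)) (n := ∞))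
  refine h2.congr_of_eventuallyEq (Filter.Eventually.of_forall fun t' => ?_)
  have h3 : (extChartAt 𝓘(ℝ, ℝ) t).symm (extChartAt 𝓘(ℝ, ℝ) t t') = t' :=
    extChartAt_posReal_symm t t'.2
  have h4 := congrArg (fun L : ℝ →L[ℝ] ℝ => L 1) (mfderiv_extChartAt_posReal_symm t t'.2)
  have h5 : ∀ s : PosReal, s = t' → ∀ c : ℝ, c = 1 →
      (⟨t', (1 : ℝ)⟩ : TangentBundle 𝓘(ℝ, ℝ) PosReal) = ⟨s, c⟩ := by
    rintro _ rfl _ rfl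
    rfl
  exact h5 _ h3 _ h4

end HalfLine

section ConeFields

variable {E : Type*} [NormedAddCommGroup E] [NormedSpace ℝ E]
  {H : Type*} [TopologicalSpace H] {I : ModelWithCorners ℝ E H}
  {M : Type*} [TopologicalSpace M] [ChartedSpace H M] [IsManifold I ∞ M]

/-- The component `a` of a smooth field `a ∂_t + X` on the cone is smooth. -/
theorem contMDiff_fst_field {C : ∀ q : Cone M, TangentSpace (coneModel I) q}
    (hC : IsSmoothField (coneModel I) C) :
    ContMDiff (coneModel I) 𝓘(ℝ, ℝ) ∞ (fun q : Cone M => (C q : ℝ × E).1) := by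
  have : IsManifold I 1 M := IsManifold.of_le (n := ∞) (by simp)
  have h1 := (contMDiff_equivTangentBundleProd (I := 𝓘(ℝ, ℝ)) (M := PosReal) (I' := I) (M' := M)
    (n := ∞)).comp hC
  have h2 := (contMDiff_fst.comp h1)
  have h3 : ContMDiff 𝓘(ℝ, ℝ) 𝓘(ℝ, ℝ) ∞ (fun t : PosReal => (t : ℝ)) := contMDiff_subtype_val
  have h4 := (h3.contMDiff_tangentMap (m := ∞) (by simp)).comp h2
  have h5 := (contMDiff_snd_tangentBundle_modelSpace ℝ 𝓘(ℝ, ℝ) (n := ∞)).comp h4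
  refine h5.congr fun q => ?_
  have h6 : (mfderiv 𝓘(ℝ, ℝ) 𝓘(ℝ, ℝ) (fun t : PosReal => (t : ℝ)) q.1 : ℝ →L[ℝ] ℝ)
      = ContinuousLinearMap.id ℝ ℝ := mfderiv_extChartAt_self (I := 𝓘(ℝ, ℝ)) (x := q.1)
  exact (congrArg (fun L : ℝ →L[ℝ] ℝ => L (C q : ℝ × E).1) h6).symm

theorem contMDiff_snd_field {C : ∀ q : Cone M, TangentSpace (coneModel I) q}
    (hC : IsSmoothField (coneModel I) C) :
    ContMDiff (coneModel I) I.tangent ∞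
      (fun q : Cone M => (⟨q.2, (C q : ℝ × E).2⟩ : TangentBundle I M)) := by
  have : IsManifold I 1 M := IsManifold.of_le (n := ∞) (by simp)
  exact contMDiff_snd.comp ((contMDiff_equivTangentBundleProd (I := 𝓘(ℝ, ℝ)) (M := PosReal)
    (I' := I) (M' := M) (n := ∞)).comp hC)

theorem isSmoothField_dt : IsSmoothField (coneModel I) (M := Cone M) (fun _ => ((1, 0) : ℝ × E)) := by
  have : IsManifold I 1 M := IsManifold.of_le (n := ∞) (by simp)
  exact (contMDiff_equivTangentBundleProd_symm (I := 𝓘(ℝ, ℝ)) (M := PosReal) (I' := I) (M' := M)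
    (n := ∞)).comp ((contMDiff_dt.comp contMDiff_fst).prodMk
      ((Bundle.contMDiff_zeroSection ℝ (fun x : M => TangentSpace I x)).comp contMDiff_snd))

theorem isSmoothField_horizontal {V : ∀ q : Cone M, TangentSpace I q.2}
    (hV : ContMDiff (coneModel I) I.tangent ∞ (fun q : Cone M => (⟨q.2, V q⟩ : TangentBundle I M))) :
    IsSmoothField (coneModel I) (M := Cone M) (fun q => ((0, V q) : ℝ × E)) := by
  have : IsManifold I 1 M := IsManifold.of_le (n := ∞) (by simp)
  exact (contMDiff_equivTangentBundleProd_symm (I := 𝓘(ℝ, ℝ)) (M := PosReal) (I' := I) (M' := M)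
    (n := ∞)).comp (((Bundle.contMDiff_zeroSection ℝ
      (fun x : PosReal => TangentSpace 𝓘(ℝ, ℝ) x)).comp contMDiff_fst).prodMk hV)

theorem isSmoothField_coneJ (S : AlmostContactMetric I M)
    {C : ∀ q : Cone M, TangentSpace (coneModel I) q} (hC : IsSmoothField (coneModel I) C) :
    IsSmoothField (coneModel I) (fun q => S.coneJ q (C q)) := by
  have h1 := contMDiff_fst_field hC
  have h2 := contMDiff_snd_field hC
  have ht : ContMDiff (coneModel I) 𝓘(ℝ, ℝ) ∞ (fun q : Cone M => (q.1 : ℝ)) :=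
    contMDiff_subtype_val.comp contMDiff_fst
  have hti : ContMDiff (coneModel I) 𝓘(ℝ, ℝ) ∞ (fun q : Cone M => (q.1 : ℝ)⁻¹) :=
    fun q => (contDiffAt_inv ℝ (ne_of_gt q.1.2)).contMDiffAt.comp q (ht q)
  have hη : ContMDiff (coneModel I) 𝓘(ℝ, ℝ) ∞
      (fun q : Cone M => S.η q.2 (C q : ℝ × E).2) := by
    have h : ContMDiff (coneModel I) (I.prod 𝓘(ℝ, ℝ)) ∞
        (fun q : Cone M => Bundle.TotalSpace.mk' ℝ (E := Bundle.Trivial M ℝ) q.2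
          (S.η q.2 (C q : ℝ × E).2)) :=
      ContMDiff.clm_bundle_apply (F₁ := E) (F₂ := ℝ) (E₁ := fun x : M => TangentSpace I x)
        (E₂ := Bundle.Trivial M ℝ) (b := fun q : Cone M => q.2) (ϕ := fun q => S.η q.2)
        (v := fun q => (C q : ℝ × E).2) (S.smooth_η.comp contMDiff_snd) h2
    exact fun q => ((Bundle.contMDiffAt_totalSpace).mp (h q)).2
  have hφ : ContMDiff (coneModel I) I.tangent ∞
      (fun q : Cone M => (⟨q.2, S.φ q.2 (C q : ℝ × E).2⟩ : TangentBundle I M)) :=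
    ContMDiff.clm_bundle_apply (F₁ := E) (F₂ := E) (E₁ := fun x : M => TangentSpace I x)
      (E₂ := fun x : M => TangentSpace I x) (b := fun q : Cone M => q.2) (ϕ := fun q => S.φ q.2)
      (v := fun q => (C q : ℝ × E).2) (S.smooth_φ.comp contMDiff_snd) h2
  have hξ : ContMDiff (coneModel I) I.tangent ∞
      (fun q : Cone M => (⟨q.2, S.ξ q.2⟩ : TangentBundle I M)) := S.smooth_ξ.comp contMDiff_snd
  have h := (((ht.mul hη).smul_section (isSmoothField_dt (I := I) (M := M))).add_section
    (isSmoothField_horizontal hφ)).sub_section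
    ((hti.mul h1).smul_section (isSmoothField_horizontal hξ))
  have hval : ∀ (c d : ℝ) (u v : E),
      ((c, u - d • v) : ℝ × E) = c • ((1, 0) : ℝ × E) + (0, u) - d • ((0, v) : ℝ × E) := by
    intro c d u v
    simp
  refine h.congr fun q => congrArg (Bundle.TotalSpace.mk' (ℝ × E) q) ?_
  refine (S.coneJ_apply q (C q : ℝ × E).1 (C q : ℝ × E).2).trans ?_
  rw [smul_smul]
  exact hval _ _ _ _

theorem isSmoothField_Phi (S : AlmostContactMetric I M) {X : ∀ x : M, TangentSpace I x}
    (hX : IsSmoothField I X) : IsSmoothField I (S.Phi X) :=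
  ContMDiff.clm_bundle_apply (F₁ := E) (F₂ := E) (E₁ := fun x : M => TangentSpace I x)
    (E₂ := fun x : M => TangentSpace I x) (b := fun x : M => x) (ϕ := S.φ) (v := X) S.smooth_φ hX

theorem exists_isSmoothField_eq [FiniteDimensional ℝ E] [T2Space M] (x : M) (v : TangentSpace I x) :
    ∃ X : ∀ x : M, TangentSpace I x, IsSmoothField I X ∧ X x = v := by
  obtain ⟨s, hs, hX⟩ := FiberBundle.exists_contMDiffOn_extend (k := ∞) I E
    (V := fun x : M => TangentSpace I x) v
  obtain ⟨f, -, hf⟩ := (SmoothBumpFunction.nhds_basis_tsupport (I := I) x).mem_iff.mp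
    (interior_mem_nhds.mpr hs)
  refine ⟨(f : M → ℝ) • FiberBundle.extend E v, ?_, ?_⟩
  · exact ContMDiffOn.smul_section_of_tsupport f.contMDiff.contMDiffOn isOpen_interior hf
      (hX.mono interior_subset)
  · simp

end ConeFields

section ConeMetric

variable {E : Type*} [NormedAddCommGroup E] [NormedSpace ℝ E]
  {H : Type*} [TopologicalSpace H] {I : ModelWithCorners ℝ E H} [I.Boundaryless]
  {M : Type*} [TopologicalSpace M] [ChartedSpace H M] [IsManifold I ∞ M]

omit [I.Boundaryless] [IsManifold I ∞ M] in
theorem extChartAt_cone (q : Cone M) : extChartAt (coneModel I) q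
    = (extChartAt 𝓘(ℝ, ℝ) q.1).prod (extChartAt I q.2) := extChartAt_prod q

theorem mfderiv_extChartAt_cone_symm (q : Cone M) {p : ℝ × E} (hp : 0 < p.1)
    (hp2 : p.2 ∈ (extChartAt I q.2).target) (A : ℝ × E) :
    (mfderiv 𝓘(ℝ, ℝ × E) (coneModel I) (extChartAt (coneModel I) q).symm p A : ℝ × E)
      = (A.1, mfderiv 𝓘(ℝ, E) I (extChartAt I q.2).symm p.2 A.2) := by
  have h1 : MDifferentiableAt 𝓘(ℝ, ℝ) 𝓘(ℝ, ℝ) (extChartAt 𝓘(ℝ, ℝ) q.1).symm p.1 :=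
    ((contMDiffOn_extChartAt_symm (n := ∞) (I := 𝓘(ℝ, ℝ)) q.1).contMDiffAt
      ((isOpen_extChartAt_target q.1).mem_nhds
        (mem_extChartAt_posReal_target q.1 hp))).mdifferentiableAt (by simp)
  have h2 : MDifferentiableAt 𝓘(ℝ, E) I (extChartAt I q.2).symm p.2 :=
    ((contMDiffOn_extChartAt_symm (n := ∞) (I := I) q.2).contMDiffAt
      ((isOpen_extChartAt_target q.2).mem_nhds hp2)).mdifferentiableAt (by simp)
  have h3 : HasMFDerivAt 𝓘(ℝ, ℝ × E) 𝓘(ℝ, ℝ) (Prod.fst : ℝ × E → ℝ) p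
    (ContinuousLinearMap.fst ℝ ℝ E) := hasFDerivAt_fst.hasMFDerivAt
  have h4 : HasMFDerivAt 𝓘(ℝ, ℝ × E) 𝓘(ℝ, E) (Prod.snd : ℝ × E → E) p
    (ContinuousLinearMap.snd ℝ ℝ E) := hasFDerivAt_snd.hasMFDerivAt
  have h5 := (h1.hasMFDerivAt.comp p h3).prodMk (h2.hasMFDerivAt.comp p h4)
  have h6 : (extChartAt (coneModel I) q).symm = fun p : ℝ × E =>
      ((extChartAt 𝓘(ℝ, ℝ) q.1).symm p.1, (extChartAt I q.2).symm p.2) := by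
    rw [extChartAt_cone]; rfl
  rw [h6]
  have h7 := congrArg (fun L : ℝ × E →L[ℝ] ℝ × E => L A) h5.mfderiv
  refine h7.trans (Prod.ext ?_ rfl)
  exact congrArg (fun L : ℝ →L[ℝ] ℝ => L A.1) (mfderiv_extChartAt_posReal_symm q.1 hp)

theorem metricInChart_coneMetric (S : AlmostContactMetric I M) (q : Cone M) {p : ℝ × E}
    (hp : 0 < p.1) (hp2 : p.2 ∈ (extChartAt I q.2).target) :
    metricInChart (coneModel I) S.coneMetric q p
      = coneCoordMetric (metricInChart I S.g.inner q.2) p := by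
  refine ContinuousLinearMap.ext fun A => ContinuousLinearMap.ext fun B => ?_
  have h0 : (extChartAt (coneModel I) q).symm p
      = ((⟨p.1, hp⟩, (extChartAt I q.2).symm p.2) : Cone M) := by
    rw [extChartAt_cone, ← extChartAt_posReal_symm q.1 hp]
    rfl
  have h1 : ∀ r : Cone M, r = ((⟨p.1, hp⟩, (extChartAt I q.2).symm p.2) : Cone M) →
      ∀ v w v' w' : ℝ × E, v = v' → w = w' → (S.coneMetric r : ℝ × E →L[ℝ] ℝ × E →L[ℝ] ℝ) v w
        = (S.coneMetric ((⟨p.1, hp⟩, (extChartAt I q.2).symm p.2) : Cone M) :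
          ℝ × E →L[ℝ] ℝ × E →L[ℝ] ℝ) v' w' := by
    rintro _ rfl _ _ _ _ rfl rfl
    rfl
  exact h1 _ h0 _ _ _ _ (mfderiv_extChartAt_cone_symm q hp hp2 A)
    (mfderiv_extChartAt_cone_symm q hp hp2 B)

theorem metricInChart_coneMetric_eventuallyEq (S : AlmostContactMetric I M) (q : Cone M) :
    metricInChart (coneModel I) S.coneMetric q
      =ᶠ[nhds ((q.1 : ℝ), extChartAt I q.2 q.2)] coneCoordMetric (metricInChart I S.g.inner q.2) := by
  have h1 : ∀ᶠ s in nhds (q.1 : ℝ), 0 < s := lt_mem_nhds q.1.2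
  filter_upwards [prod_mem_nhds h1 (extChartAt_target_mem_nhds q.2)] with p hp
  exact metricInChart_coneMetric S q hp.1 hp.2

/-- The pointwise tensor `g(v, w) g(u, z) - g(u, w) g(v, z) + R(u, v, w, z)` at `x`, the horizontal
part of the curvature of the cone at height `1`. -/
def coneTensor (S : AlmostContactMetric I M) (x : M) (u v w z : E) : ℝ :=
  let γ := metricInChart I S.g.inner x (extChartAt I x x)
  γ v w * γ u z - γ u w * γ v z
    - γ (curvatureOp (christoffelL (metricInChart I S.g.inner x)) (extChartAt I x x) u v w) z

theorem R_eq_coneTensor [FiniteDimensional ℝ E] (S : AlmostContactMetric I M)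
    {X Y Z : ∀ x : M, TangentSpace I x} (W : ∀ x : M, TangentSpace I x)
    (hX : IsSmoothField I X) (hY : IsSmoothField I Y) (hZ : IsSmoothField I Z) (x : M) :
    S.R X Y Z W x = coneTensor S x (X x) (Y x) (Z x) (W x)
      - S.g.inner x (Y x) (Z x) * S.g.inner x (X x) (W x)
      + S.g.inner x (X x) (Z x) * S.g.inner x (Y x) (W x) := by
  refine (riemannChristoffel_eq (Filter.EventuallyEq.refl _ _)
    (isMetricAt_metricInChart S.g x (mem_extChartAt_target x)) W hX hY hZ).trans ?_
  have key : ∀ u v w z : E, -metricInChart I S.g.inner x (extChartAt I x x)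
      (curvatureOp (christoffelL (metricInChart I S.g.inner x)) (extChartAt I x x) u v w) z
      = coneTensor S x u v w z
        - metricInChart I S.g.inner x (extChartAt I x x) v w
          * metricInChart I S.g.inner x (extChartAt I x x) u z
        + metricInChart I S.g.inner x (extChartAt I x x) u w
          * metricInChart I S.g.inner x (extChartAt I x x) v z := by
    intro u v w z
    rw [coneTensor]
    ring
  refine (key _ _ _ _).trans ?_
  rw [metricInChart_self]
  rfl

theorem riemannChristoffel_cone [FiniteDimensional ℝ E] (S : AlmostContactMetric I M)
    {A B C : ∀ q : Cone M, TangentSpace (coneModel I) q}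
    (D : ∀ q : Cone M, TangentSpace (coneModel I) q)
    (hA : IsSmoothField (coneModel I) A) (hB : IsSmoothField (coneModel I) B)
    (hC : IsSmoothField (coneModel I) C) (q : Cone M) :
    riemannChristoffel (coneModel I) S.coneMetric A B C D q
      = (q.1 : ℝ) ^ 2 * coneTensor S q.2 (A q : ℝ × E).2 (B q : ℝ × E).2 (C q : ℝ × E).2
          (D q : ℝ × E).2 := by
  have hq : (q.1 : ℝ) ≠ 0 := ne_of_gt q.1.2
  have hbase : extChartAt (coneModel I) q q = ((q.1 : ℝ), extChartAt I q.2 q.2) := by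
    rw [extChartAt_cone]
    rfl
  have hm : ∀ᶠ z in nhds (extChartAt I q.2 q.2), IsMetricAt (metricInChart I S.g.inner q.2) z := by
    filter_upwards [extChartAt_target_mem_nhds q.2] with z hz
    exact isMetricAt_metricInChart S.g q.2 hz
  have hG := metricInChart_coneMetric_eventuallyEq S q
  have hmC := hm.self_of_nhds.coneCoordMetric (p := ((q.1 : ℝ), extChartAt I q.2 q.2)) hq
  rw [← hbase] at hG hmC
  refine (riemannChristoffel_eq hG hmC D hA hB hC).trans ?_
  have key : ∀ a b c d : ℝ × E, -coneCoordMetric (metricInChart I S.g.inner q.2)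
      ((q.1 : ℝ), extChartAt I q.2 q.2)
      (curvatureOp (christoffelL (coneCoordMetric (metricInChart I S.g.inner q.2)))
        ((q.1 : ℝ), extChartAt I q.2 q.2) a b c) d
      = (q.1 : ℝ) ^ 2 * coneTensor S q.2 a.2 b.2 c.2 d.2 := by
    intro a b c d
    rw [curvatureOp_coneCoordMetric hq hm, coneCoordMetric_apply, coneTensor]
    simp only [map_add, map_sub, map_smul, add_apply, sub_apply, smul_apply, smul_eq_mul]
    ring
  rw [hbase]
  exact key _ _ _ _

end ConeMetric


section Gray

variable {E : Type*} [NormedAddCommGroup E] [NormedSpace ℝ E]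
  {H : Type*} [TopologicalSpace H] {I : ModelWithCorners ℝ E H}
  {M : Type*} [TopologicalSpace M] [ChartedSpace H M] [IsManifold I ∞ M]

theorem coneTensor_zero_left (S : AlmostContactMetric I M) (x : M) (u v z : E) :
    coneTensor S x u v 0 z = 0 := by
  simp [coneTensor, curvatureOp]

theorem coneTensor_zero_right (S : AlmostContactMetric I M) (x : M) (u v w : E) :
    coneTensor S x u v w 0 = 0 := by
  simp [coneTensor]

theorem coneTensor_sub_smul_left (S : AlmostContactMetric I M) (x : M) (c : ℝ) (u v w w' z : E) :
    coneTensor S x u v (w - c • w') z = coneTensor S x u v w z - c * coneTensor S x u v w' z := by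
  simp only [coneTensor, curvatureOp, map_add, map_sub, map_smul, add_apply, sub_apply, smul_apply,
    smul_eq_mul]
  ring

theorem coneTensor_sub_smul_right (S : AlmostContactMetric I M) (x : M) (c : ℝ) (u v w z z' : E) :
    coneTensor S x u v w (z - c • z') = coneTensor S x u v w z - c * coneTensor S x u v w z' := by
  simp only [coneTensor, map_sub, map_smul, smul_eq_mul]
  ring

variable [FiniteDimensional ℝ E] [I.Boundaryless] [T2Space M]

theorem grayK1_cone_iff (S : AlmostContactMetric I M) :
    GrayK1 (coneModel I) S.coneMetric S.coneJ ↔ ∀ (x : M) (u v w z : TangentSpace I x),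
      coneTensor S x u v w z = coneTensor S x u v (S.φ x w) (S.φ x z) := by
  constructor
  · intro h x u v w z
    obtain ⟨X, hX, rfl⟩ := exists_isSmoothField_eq x u
    obtain ⟨Y, hY, rfl⟩ := exists_isSmoothField_eq x v
    obtain ⟨Z, hZ, rfl⟩ := exists_isSmoothField_eq x w
    obtain ⟨W, hW, rfl⟩ := exists_isSmoothField_eq x z
    have hl {X : ∀ x : M, TangentSpace I x} (hX : IsSmoothField I X) :=
      isSmoothField_horizontal (V := fun q : Cone M => X q.2) (hX.comp contMDiff_snd)
    have h1 := h _ _ _ _ (hl hX) (hl hY) (hl hZ) (hl hW) ((⟨1, one_pos (α := ℝ)⟩, x) : Cone M)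
    have h0 : ∀ (s : ℝ) (w ξ : E), w - s • (0 : ℝ) • ξ = w := by simp
    have h2 : ∀ v : E, (S.coneJ ((⟨1, one_pos (α := ℝ)⟩, x) : Cone M) ((0, v) : ℝ × E) : ℝ × E).2
        = S.φ x v :=
      fun v => (congrArg Prod.snd (S.coneJ_apply _ 0 v)).trans (h0 _ _ _)
    have h3 := ((riemannChristoffel_cone S _ (hl hX) (hl hY) (hl hZ) _).symm.trans h1).trans
      (riemannChristoffel_cone S _ (hl hX) (hl hY) (isSmoothField_coneJ S (hl hZ)) _)
    have h4 := mul_left_cancel₀ (pow_ne_zero 2 one_ne_zero) h3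
    exact h4.trans (congrArg₂ (coneTensor S x (X x) (Y x)) (h2 _) (h2 _))
  · intro h A B C D hA hB hC hD q
    rw [riemannChristoffel_cone S _ hA hB hC,
      riemannChristoffel_cone S _ hA hB (isSmoothField_coneJ S hC)]
    congr 1
    have hξl (u v z : E) : coneTensor S q.2 u v (S.ξ q.2) z = 0 := by
      rw [h q.2 u v (S.ξ q.2) z, S.φ_ξ]
      exact coneTensor_zero_left ..
    have hξr (u v w : E) : coneTensor S q.2 u v w (S.ξ q.2) = 0 := by
      rw [h q.2 u v w (S.ξ q.2), S.φ_ξ]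
      exact coneTensor_zero_right ..
    have key : ∀ (ξ u v w z : E) (c d s : ℝ), (∀ u v z, coneTensor S q.2 u v ξ z = 0) →
        (∀ u v w, coneTensor S q.2 u v w ξ = 0) →
        coneTensor S q.2 u v (w - s • c • ξ) (z - s • d • ξ) = coneTensor S q.2 u v w z := by
      intro ξ u v w z c d s hl hr
      rw [smul_smul, smul_smul, coneTensor_sub_smul_left, coneTensor_sub_smul_right, hl, hr]
      ring
    exact (h _ _ _ _ _).trans (key (S.ξ q.2) _ _ _ _ _ _ _ hξl hξr).symm

theorem curvature_identity_iff (S : AlmostContactMetric I M) :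
    (∀ X Y Z W : ∀ x : M, TangentSpace I x,
      IsSmoothField I X → IsSmoothField I Y → IsSmoothField I Z → IsSmoothField I W → ∀ x : M,
        S.R X Y Z W x = S.R X Y (S.Phi Z) (S.Phi W) x
          - S.g.inner x (X x) (S.Phi Z x) * S.g.inner x (Y x) (S.Phi W x)
          + S.g.inner x (Y x) (S.Phi Z x) * S.g.inner x (X x) (S.Phi W x)
          - S.g.inner x (Y x) (Z x) * S.g.inner x (X x) (W x)
          + S.g.inner x (X x) (Z x) * S.g.inner x (Y x) (W x)) ↔
      ∀ (x : M) (u v w z : TangentSpace I x),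
        coneTensor S x u v w z = coneTensor S x u v (S.φ x w) (S.φ x z) := by
  constructor
  · intro h x u v w z
    obtain ⟨X, hX, rfl⟩ := exists_isSmoothField_eq x u
    obtain ⟨Y, hY, rfl⟩ := exists_isSmoothField_eq x v
    obtain ⟨Z, hZ, rfl⟩ := exists_isSmoothField_eq x w
    obtain ⟨W, hW, rfl⟩ := exists_isSmoothField_eq x z
    have h1 := h X Y Z W hX hY hZ hW x
    rw [R_eq_coneTensor S W hX hY hZ, R_eq_coneTensor S _ hX hY (isSmoothField_Phi S hZ)] at h1
    simp only [AlmostContactMetric.Phi] at h1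
    linarith
  · intro h X Y Z W hX hY hZ hW x
    have h1 := h x (X x) (Y x) (Z x) (W x)
    rw [R_eq_coneTensor S W hX hY hZ, R_eq_coneTensor S _ hX hY (isSmoothField_Phi S hZ)]
    simp only [AlmostContactMetric.Phi]
    linarith

end Gray

end ConeGray

end

theorem mainTheorem1
    {E : Type*} [NormedAddCommGroup E] [NormedSpace ℝ E] [FiniteDimensional ℝ E]
    {H : Type*} [TopologicalSpace H] (I : ModelWithCorners ℝ E H) [I.Boundaryless]
    {M : Type*} [TopologicalSpace M] [T2Space M] [ChartedSpace H M] [IsManifold I ∞ M]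
    (S : ConeGray.AlmostContactMetric I M) :
    (ConeGray.GrayK1 (ConeGray.coneModel I) S.coneMetric S.coneJ ↔
      ∀ X Y Z W : ∀ x : M, TangentSpace I x,
        ConeGray.IsSmoothField I X → ConeGray.IsSmoothField I Y →
        ConeGray.IsSmoothField I Z → ConeGray.IsSmoothField I W → ∀ x : M,
          S.R X Y Z W x = S.R X Y (S.Phi Z) (S.Phi W) x
            - S.g.inner x (X x) (S.Phi Z x) * S.g.inner x (Y x) (S.Phi W x)
            + S.g.inner x (Y x) (S.Phi Z x) * S.g.inner x (X x) (S.Phi W x)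
            - S.g.inner x (Y x) (Z x) * S.g.inner x (X x) (W x)
            + S.g.inner x (X x) (Z x) * S.g.inner x (Y x) (W x)) ∧
    (ConeGray.GrayK1 (ConeGray.coneModel I) S.coneMetric S.coneJ ↔ S.IsG1) := by
  have h := (ConeGray.grayK1_cone_iff S).trans (ConeGray.curvature_identity_iff S).symm
  refine ⟨h, h.trans ⟨fun h1 X Y Z W hX hY hZ hW x => ?_, fun h1 X Y Z W hX hY hZ hW x => ?_⟩⟩
  · linarith [h1 X Y Z W hX hY hZ hW x]
  · linarith [h1 X Y Z W hX hY hZ hW x]
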